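/- Fix a universal programming language $U$: a computable partial function $U(p,Y)$ of two binary strings (program $p$, input $Y$) such that, with $K_L(X\mid Y)=\min\{|p| : L(p,Y)=X\}$, for every computable language $L$ one has $K_U(X\mid Y)\le K_L(X\mid Y)+O(1)$ for all strings $X,Y$ (the $O(1)$ may depend on $L$ but not on $X,Y$). Let $K(X)=K_U(X\mid \text{empty string})$, and let $K(X_1,\dots,X_m)$ be the complexity of the string that encodes the tuple $(X_1,\dots,X_m)$ in a fixed standard (computable, injective) way. Put $$I(X:Y)=K(X)+K(Y)-K(X,Y),\qquad I(X:Y\mid Z)=K(X,Z)+K(Y,Z)-K(X,Y,Z)-K(Z).$$ For $n\ge 1$ let $\mathbb{F}_n$ be the field with $2^n$ elements, and let its elements be represented by the binary strings of length $n$ through a bijection for which addition and multiplication are computable uniformly in $n$. A point $(x,y)$ of the affine plane $\mathbb{F}_n^2$ is represented by the strings of its two coordinates; a line, with equation $y=c_1x+c_2$ or $x=c$, is represented by one bit for its type and the strings of its parameters. Then for every constant $k$ there is a constant $\kappa$, depending only on $k$, on $U$ and on the chosen representation of the fields, such that the following holds for all $n\ge 1$. Let $C$ be (the string of) a line in the affine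 plane over $\mathbb{F}_n$ and let $A,B$ be (the strings of) two points incident to this line, such that the triple has maximal complexity up to the constant $k$, i.e. $|K(A,B,C)-4n|\le k$. Then for every binary string $D$, $$I(C:D)\le I(C:D\mid A)+I(C:D\mid B)+\kappa\,\log (N+2),\qquad N=K(A,B,C,D).$$ -/

import Mathlib

namespace AlgInfo

/-! ### Kolmogorov complexity -/

/-- A programming language: a partial function that sends a program `p` and an input `y` (both
binary strings) to the string printed by `p` on input `y`, if there is one.  Languages are required
to be computable (`Partrec₂ L`) wherever this matters. -/
abbrev ProgLang : Type := List Bool → List Bool →. List Bool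

/-- `K_L(x | y)`: the least length of a program that prints `x` on input `y` in the language `L`
(`⊤` if there is no such program). -/
noncomputable def condComplexity (L : ProgLang) (x y : List Bool) : ℕ∞ :=
  ⨅ (p : List Bool) (_ : x ∈ L p y), (p.length : ℕ∞)

/-- A universal programming language: it is computable, and for every computable language `L`
we have `K_U(x | y) ≤ K_L(x | y) + O(1)`, where the `O(1)` does not depend on `x` and `y`. -/
structure IsUniversal (U : ProgLang) : Prop where
  partrec : Partrec₂ U
  optimal : ∀ L : ProgLang, Partrec₂ L →
    ∃ c : ℕ, ∀ x y : List Bool, condComplexity U x y ≤ condComplexity L x y + c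

/-- Complexities with respect to a universal language are finite. -/
theorem IsUniversal.condComplexity_ne_top {U : ProgLang} (hU : IsUniversal U) (x y : List Bool) :
    condComplexity U x y ≠ ⊤ := by
  obtain ⟨c, hc⟩ := hU.optimal (fun p _ => Part.some p) (Computable.fst (α := List Bool))
  have h : condComplexity (fun p _ => Part.some p) x y ≤ (x.length : ℕ∞) := by
    unfold condComplexity
    exact iInf₂_le (f := fun (p : List Bool) (_ : x ∈ Part.some p) => (p.length : ℕ∞)) x
      (Part.mem_some x)
  intro htop
  have h' := (hc x y).trans (add_le_add_left h (c : ℕ∞))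
  rw [htop, top_le_iff] at h'
  exact ENat.natCast_ne_top (x.length + c) (by exact_mod_cast h')

/-- The unconditional complexity `K_U(x)`: the complexity of `x` given the empty string.
(For universal `U` the value of `condComplexity` is finite.) -/
noncomputable def complexity (U : ProgLang) (x : List Bool) : ℕ :=
  (condComplexity U x []).toNat

/-- The encoding of a finite tuple of strings by one string: every bit of an entry is preceded by
`true`, and every entry is followed by `false`. -/
def tuple (l : List (List Bool)) : List Bool :=
  l.flatMap fun x => (x.flatMap fun b => [true, b]) ++ [false]

/-- The complexity `K_U(x₁, …, xₘ)` of a tuple of strings. -/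
noncomputable def tupleComplexity (U : ProgLang) (l : List (List Bool)) : ℕ :=
  complexity U (tuple l)

/-- Mutual information `I(x : y) = K(x) + K(y) - K(x, y)`. -/
noncomputable def mutualInfo (U : ProgLang) (x y : List Bool) : ℤ :=
  (complexity U x : ℤ) + complexity U y - tupleComplexity U [x, y]

/-- Conditional mutual information `I(x : y | z) = K(x, z) + K(y, z) - K(x, y, z) - K(z)`. -/
noncomputable def condMutualInfo (U : ProgLang) (x y z : List Bool) : ℤ :=
  (tupleComplexity U [x, z] : ℤ) + tupleComplexity U [y, z] - tupleComplexity U [x, y, z]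
    - complexity U z

/-! ### The affine plane over the field with `2 ^ n` elements, and its points and lines as strings -/

/-- An effective representation of the elements of the fields `𝔽ₙ` with `2 ^ n` elements (`n ≥ 1`)
by binary strings: `enc n` is a bijection of `𝔽ₙ` onto the strings of length `n`, and addition and
multiplication are computed by algorithms that are uniform in `n`.  The coefficient strings of
polynomials modulo the lexicographically first irreducible polynomial of degree `n` over `𝔽₂`
are an example. -/
structure IsEffectiveEncoding (enc : ∀ n : ℕ, GaloisField 2 n → List Bool) : Prop where
  bijOn : ∀ n : ℕ, 1 ≤ n → Set.BijOn (enc n) Set.univ {s | s.length = n}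
  add : ∃ f : ℕ × List Bool × List Bool → List Bool, Computable f ∧
    ∀ n : ℕ, 1 ≤ n → ∀ x y : GaloisField 2 n, f (n, enc n x, enc n y) = enc n (x + y)
  mul : ∃ f : ℕ × List Bool × List Bool → List Bool, Computable f ∧
    ∀ n : ℕ, 1 ≤ n → ∀ x y : GaloisField 2 n, f (n, enc n x, enc n y) = enc n (x * y)

/-- The lines of the affine plane `F × F`: the line `slanted c₁ c₂` has the equation
`y = c₁ * x + c₂`, and the line `vertical c` has the equation `x = c`. -/
inductive Line (F : Type*) where
  | slanted (c₁ c₂ : F) : Line F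
  | vertical (c : F) : Line F

/-- The point `P` is incident to the line. -/
def Line.Incident {F : Type*} [Field F] (P : F × F) : Line F → Prop
  | .slanted c₁ c₂ => c₁ * P.1 + c₂ = P.2
  | .vertical c => P.1 = c

/-- A point as a string: the strings of its two coordinates. -/
def pointString {F : Type*} (enc : F → List Bool) (P : F × F) : List Bool :=
  enc P.1 ++ enc P.2

/-- A line as a string: one bit for the type of the line, then the strings of its parameters. -/
def lineString {F : Type*} (enc : F → List Bool) : Line F → List Bool
  | .slanted c₁ c₂ => true :: (enc c₁ ++ enc c₂)
  | .vertical c => false :: enc c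

end AlgInfo

/-!
Write `K(X | D)` informally for `K(X, D) - K(D)`.  Since `K(A, B, C)` is as large as possible, all
complexities without `D` are known up to `O(log n)`: lines and points have complexity at most `2n`,
and a point costs only `n` bits once a line through it is known, so that
`K(C) ≤ 2n`, `K(A), K(B) ≤ 2n` and `K(A, C), K(B, C) ≥ 3n`.  The claim then reduces to
`K(C | A, D) + K(C | B, D) ≤ K(C | D)`, or, in terms of unconditional complexities,
`K(A, C, D) + K(B, C, D) + K(D) ≤ K(A, D) + K(B, D) + K(C, D)`.
This holds, up to a logarithmic term, for every line `C` with two distinct points `A` and `B`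
(`IsUniversal.exists_complexity_incidence_le`), because distinct points determine the line.

For the proof let `S` be the set of points `P` of `C` with `K(P, D) ≤ K(A, D)`, and `T` the set of
all `P` with `K(P, D) ≤ K(A, D)`; define `S'` and `T'` with `B` in place of `A`.  All these
sets can be enumerated, whence
* `K(A, C, D) ≤ K(C, D) + log |S|`, since `A` is given by its index in the enumeration of `S`, and
  likewise `K(B, C, D) ≤ K(C, D) + log |S'|`;
* `K(D) + log |T| ≤ K(A, D)`, since few strings `D` have so many simple `P`, and likewise
  `K(D) + log |T'| ≤ K(B, D)`;
* `K(C, D) ≤ K(D) + log |T| + log |T'| - log |S| - log |S'|`: a pair of distinct points in `T × T'`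
  lies on only one line, so there are few lines with as many such pairs as `C`.
The sum of these inequalities is the claim.  The first one is an instance of
`IsUniversal.exists_complexity_le_index`, the other two are instances of
`IsUniversal.exists_complexity_add_le_of_encard`.

The points `A` and `B` may coincide, but then `K(A, B, C)` is at most about `3n`, and maximality forces `n`
to be logarithmically small, so that the line `C` is negligible.
-/

namespace AlgInfo

/-! ### Recursively enumerable families of sets -/

theorem length_le_encard {X : Type*} {S : Set X} {l : List X} (hl : l.Nodup) (h : ∀ x ∈ l, x ∈ S) :
    (l.length : ℕ∞) ≤ S.encard := by
  classical
  rw [← List.toFinset_card_of_nodup hl, ← Set.encard_coe_eq_coe_finsetCard]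
  exact Set.encard_le_encard fun x hx => h x (by simpa using hx)

section Enumerability

variable {α β X : Type*} [Primcodable α] [Primcodable β] [Primcodable X]

theorem rePred_of_exists_computable {p : α → Prop} {g : α × ℕ → Bool} (hg : Computable g)
    (H : ∀ a, p a ↔ ∃ t, g (a, t) = true) : REPred p := by
  have h : Partrec fun a : α => Nat.rfind fun t => Part.some (g (a, t)) :=
    Partrec.rfind (p := fun a t => Part.some (g (a, t))) hg
  refine h.dom_re.of_eq fun a => ?_
  refine Nat.rfind_dom'.trans (Iff.trans ?_ (H a).symm)
  constructor
  · rintro ⟨t, ht, -⟩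
    exact ⟨t, (Part.mem_some_iff.1 ht).symm⟩
  · rintro ⟨t, ht⟩
    exact ⟨t, Part.mem_some_iff.2 ht.symm, fun _ => trivial⟩

/-- A recursively enumerable predicate holds where a computable search succeeds. -/
theorem exists_computable_of_rePred {p : α → Prop} (hp : REPred p) :
    ∃ g : α × ℕ → Bool, Computable g ∧ ∀ a, p a ↔ ∃ t, g (a, t) = true := by
  obtain ⟨c, hc⟩ := Nat.Partrec.Code.exists_code.1 hp
  refine ⟨fun q => (Nat.Partrec.Code.evaln q.2 c (Encodable.encode q.1)).isSome, ?_, fun a => ?_⟩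
  · have h := Nat.Partrec.Code.primrec_evaln.comp
      ((Primrec.snd.pair (Primrec.const c)).pair
        (Primrec.encode.comp Primrec.fst) : Primrec fun q : α × ℕ =>
          ((q.2, c), Encodable.encode q.1))
    exact (Primrec.option_isSome.comp h).to_comp
  · have hdom : (Nat.Partrec.Code.eval c (Encodable.encode a)).Dom ↔ p a := by
      rw [hc]
      simp [Part.assert]
    rw [← hdom, Part.dom_iff_mem]
    simp only [Nat.Partrec.Code.evaln_complete, Option.isSome_iff_exists, Option.mem_def]
    exact exists_comm

theorem rePred_of_computable {g : α → Bool} (hg : Computable g) : REPred fun a => g a = true :=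
  rePred_of_exists_computable (g := fun q => g q.1) (hg.comp Computable.fst) fun _ => by simp

theorem rePred_eq {f g : α → β}
    (hf : Computable f) (hg : Computable g) : REPred fun a => f a = g a := by
  classical
  exact (rePred_of_computable (Primrec.eq.decide.to_comp.comp hf hg)).of_eq fun a => by simp

theorem rePred_comp {p : β → Prop} (hp : REPred p) {f : α → β} (hf : Computable f) :
    REPred fun a => p (f a) :=
  Partrec.comp hp hf

theorem rePred_and {p q : α → Prop} (hp : REPred p) (hq : REPred q) :
    REPred fun a => p a ∧ q a := by
  refine (Partrec.dom_re (hp.bind (hq.comp (Computable.fst (α := α) (β := Unit))).to₂)).of_eq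
    fun a => ?_
  simp [Part.assert]

theorem rePred_exists {p : α × β → Prop} (hp : REPred p) : REPred fun a => ∃ b, p (a, b) := by
  obtain ⟨g, hg, H⟩ := exists_computable_of_rePred hp
  have hdec : Computable fun q : α × ℕ => (Encodable.decode q.2.unpair.1 : Option β) :=
    Computable.decode.comp (Computable.fst.comp (Computable.unpair.comp Computable.snd))
  have hg' : Computable₂ fun (q : α × ℕ) (b : β) => g ((q.1, b), q.2.unpair.2) :=
    hg.comp (((Computable.fst.comp Computable.fst).pair Computable.snd).pair
      (Computable.snd.comp (Computable.unpair.comp (Computable.snd.comp Computable.fst))))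
  refine rePred_of_exists_computable (g := fun q : α × ℕ =>
    ((Encodable.decode q.2.unpair.1 : Option β).map
      fun b => g ((q.1, b), q.2.unpair.2)).getD false)
    (Computable.option_getD (Computable.option_map hdec hg') (Computable.const false))
    fun a => ?_
  simp only [H]
  constructor
  · rintro ⟨b, t, h⟩
    exact ⟨Nat.pair (Encodable.encode b) t, by simpa using h⟩
  · rintro ⟨t, h⟩
    cases hd : (Encodable.decode t.unpair.1 : Option β) with
    | none => simp [hd] at h
    | some b => exact ⟨b, _, by simpa [hd] using h⟩

/-- The graph of a partial recursive function is recursively enumerable. -/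
theorem rePred_mem {f : α →. X} (hf : Partrec f) : REPred fun q : α × X => q.2 ∈ f q.1 := by
  classical
  have heq : Computable₂ fun (q : α × X) (x : X) => decide (x = q.2) :=
    (Primrec.eq.decide.to_comp.comp Computable.snd (Computable.snd.comp Computable.fst))
  have h : Partrec fun q : α × X => (f q.1).bind fun x =>
      ((bif decide (x = q.2) then some () else none : Option Unit) : Part Unit) :=
    (hf.comp Computable.fst).bind (Computable.ofOption
      (Computable.cond heq (Computable.const (some ())) (Computable.const none)))
  refine h.dom_re.of_eq fun q => ?_
  rw [Part.dom_iff_mem]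
  simp only [Part.mem_bind_iff]
  constructor
  · rintro ⟨_, x, hx, h⟩
    by_cases hxq : x = q.2
    · exact hxq ▸ hx
    · simp [hxq] at h
  · intro hx
    exact ⟨(), _, hx, by simp⟩

/-- A uniformly recursively enumerable family of sets can be listed without repetitions by
computable increasing stages. -/
theorem exists_stages {p : α × X → Prop} (hp : REPred p) :
    ∃ L : α → ℕ → List X, Computable₂ L ∧ (∀ a t, (L a t).Nodup) ∧
      (∀ a t, ∀ x ∈ L a t, p (a, x)) ∧ (∀ a s t, s ≤ t → L a s <+: L a t) ∧
      ∀ a x, p (a, x) → ∃ t, x ∈ L a t := by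
  classical
  obtain ⟨g, hg, H⟩ := exists_computable_of_rePred hp
  -- the element that step `t` puts forward, if there is one
  let cand : α × ℕ → Option X := fun q =>
    (Encodable.decode q.2.unpair.1 : Option X).bind fun x =>
      bif g ((q.1, x), q.2.unpair.2) then some x else none
  have hcand : Computable cand := by
    refine Computable.option_bind (Computable.decode.comp
      (Computable.fst.comp (Computable.unpair.comp Computable.snd))) ?_
    refine Computable.cond (hg.comp (((Computable.fst.comp Computable.fst).pair
      Computable.snd).pair (Computable.snd.comp (Computable.unpair.comp
        (Computable.snd.comp Computable.fst))))) ?_ ?_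
    · exact Computable.option_some.comp Computable.snd
    · exact Computable.const none
  have hcand_mem : ∀ a t x, cand (a, t) = some x → p (a, x) := by
    intro a t x h
    simp only [cand, Option.bind_eq_some_iff] at h
    obtain ⟨y, -, hy⟩ := h
    cases hgy : g ((a, y), t.unpair.2) with
    | false => simp [hgy] at hy
    | true =>
      simp only [hgy, cond_true, Option.some.injEq] at hy
      exact hy ▸ (H _).2 ⟨_, hgy⟩
  have hcand_ex : ∀ a x, p (a, x) → ∃ t, cand (a, t) = some x := by
    intro a x h
    obtain ⟨t, ht⟩ := (H _).1 h
    exact ⟨Nat.pair (Encodable.encode x) t, by simp [cand, ht]⟩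
  -- append an element unless it is already listed
  let ins : List X × X → List X := fun q =>
    bif decide (q.1.idxOf q.2 < q.1.length) then q.1 else q.1 ++ [q.2]
  have hins : Computable ins := by
    refine Computable.cond ?_ Computable.fst
      ((Computable.list_concat (α := X)).comp Computable.fst Computable.snd)
    have hidx : Primrec fun q : List X × X => q.1.idxOf q.2 :=
      Primrec.list_idxOf.comp Primrec.snd Primrec.fst
    have hlen : Primrec fun q : List X × X => q.1.length :=
      Primrec.list_length.comp Primrec.fst
    exact (Primrec.nat_lt.decide.comp hidx hlen).to_comp
  have ins_of_mem : ∀ l x, x ∈ l → ins (l, x) = l := by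
    intro l x h
    simp [ins, List.idxOf_lt_length_iff, h]
  have ins_of_notMem : ∀ l x, x ∉ l → ins (l, x) = l ++ [x] := by
    intro l x h
    simp [ins, List.idxOf_lt_length_iff, h]
  let L : α → ℕ → List X := fun a t =>
    Nat.rec [] (fun s l => (cand (a, s)).casesOn l fun x => ins (l, x)) t
  have hL : Computable₂ L := by
    refine Computable.nat_rec (f := fun q : α × ℕ => q.2) (g := fun _ => ([] : List X))
      (h := fun (q : α × ℕ) (r : ℕ × List X) =>
        (cand (q.1, r.1)).casesOn r.2 fun x => ins (r.2, x))
      Computable.snd (Computable.const _) ?_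
    refine Computable.option_casesOn (hcand.comp ((Computable.fst.comp Computable.fst).pair
      (Computable.fst.comp Computable.snd))) (Computable.snd.comp Computable.snd) ?_
    exact hins.comp ((Computable.snd.comp (Computable.snd.comp Computable.fst)).pair
      Computable.snd)
  have hL0 : ∀ a, L a 0 = [] := fun a => rfl
  have hLs : ∀ a t, L a (t + 1) = (cand (a, t)).casesOn (L a t) fun x => ins (L a t, x) :=
    fun a t => rfl
  have hcases : ∀ a t, L a (t + 1) = L a t ∨
      ∃ x, cand (a, t) = some x ∧ x ∉ L a t ∧ L a (t + 1) = L a t ++ [x] := by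
    intro a t
    rw [hLs]
    cases hc : cand (a, t) with
    | none => exact Or.inl rfl
    | some x =>
      rcases Classical.em (x ∈ L a t) with hx | hx
      · exact Or.inl (ins_of_mem _ _ hx)
      · exact Or.inr ⟨x, rfl, hx, ins_of_notMem _ _ hx⟩
  refine ⟨L, hL, fun a t => ?_, fun a t => ?_, fun a s t hst => ?_, fun a x hx => ?_⟩
  · induction t with
    | zero => simp [hL0]
    | succ t ih =>
      rcases hcases a t with h | ⟨x, -, hx, h⟩
      · rwa [h]
      · rw [h]
        exact List.nodup_append.2 ⟨ih, by simp, by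
          rintro y hy z hz rfl
          exact hx (List.mem_singleton.1 hz ▸ hy)⟩
  · induction t with
    | zero => simp [hL0]
    | succ t ih =>
      rcases hcases a t with h | ⟨x, hx, -, h⟩
      · rwa [h]
      · rw [h]
        intro y hy
        rcases List.mem_append.1 hy with hy | hy
        · exact ih y hy
        · exact List.mem_singleton.1 hy ▸ hcand_mem a t x hx
  · induction t, hst using Nat.le_induction with
    | base => exact List.prefix_rfl
    | succ t _ ih =>
      rcases hcases a t with h | ⟨x, -, -, h⟩
      · rwa [h]
      · rw [h]
        exact ih.trans (List.prefix_append _ _)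
  · obtain ⟨t, ht⟩ := hcand_ex a x hx
    refine ⟨t + 1, ?_⟩
    rw [hLs, ht]
    rcases Classical.em (x ∈ L a t) with h | h
    · change x ∈ ins (L a t, x)
      rwa [ins_of_mem _ _ h]
    · change x ∈ ins (L a t, x)
      simp [ins_of_notMem _ _ h]

/-- In a uniformly recursively enumerable family of sets, the elements of a set with at most `s`
elements are found effectively from their indices `i < s`. -/
theorem exists_partrec_nth {p : α × X → Prop} (hp : REPred p) :
    ∃ nth : α × ℕ →. X, Partrec nth ∧ ∀ a x, p (a, x) → ∀ s : ℕ,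
      {x | p (a, x)}.encard ≤ s → ∃ i < s, x ∈ nth (a, i) := by
  obtain ⟨L, hL, hnd, hsub, hmono, hex⟩ := exists_stages hp
  refine ⟨fun q => Nat.rfindOpt fun t => (L q.1 t)[q.2]?, ?_, fun a x hx s hs => ?_⟩
  · refine Partrec.rfindOpt ?_
    exact Computable.list_getElem?.comp (hL.comp (Computable.fst.comp Computable.fst)
      Computable.snd) (Computable.snd.comp Computable.fst)
  · obtain ⟨t, ht⟩ := hex a x hx
    obtain ⟨i, hi, rfl⟩ := List.mem_iff_getElem.1 ht
    refine ⟨i, ?_, ?_⟩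
    · have := (length_le_encard (hnd a t) (S := {x | p (a, x)}) (hsub a t)).trans hs
      exact hi.trans_le (by exact_mod_cast this)
    · refine (Nat.rfindOpt_mono ?_).2 ⟨t, by simp [hi]⟩
      intro y m n hmn hy
      simp only [Option.mem_def] at hy ⊢
      obtain ⟨h1, h2⟩ := List.getElem?_eq_some_iff.1 hy
      have hpre := hmono a m n hmn
      rw [List.getElem?_eq_some_iff]
      exact ⟨h1.trans_le hpre.length_le, by rw [← h2, hpre.getElem]⟩

/-- In a uniformly recursively enumerable family of sets, it is recursively enumerable that a set
has at least `k` elements. -/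
theorem rePred_le_encard {p : α × X → Prop} (hp : REPred p) :
    REPred fun q : α × ℕ => (q.2 : ℕ∞) ≤ {x | p (q.1, x)}.encard := by
  classical
  obtain ⟨L, hL, hnd, hsub, hmono, hex⟩ := exists_stages hp
  refine rePred_of_exists_computable
    (g := fun r : (α × ℕ) × ℕ => decide (r.1.2 ≤ (L r.1.1 r.2).length)) ?_ fun q => ?_
  · exact Primrec.nat_le.decide.to_comp.comp (Computable.snd.comp Computable.fst)
      (Computable.list_length.comp (hL.comp (Computable.fst.comp Computable.fst) Computable.snd))
  · simp only [decide_eq_true_eq]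
    constructor
    · intro h
      obtain ⟨T, hT, hc⟩ := Set.exists_subset_encard_eq h
      have hfin : T.Finite := Set.finite_of_encard_eq_coe hc
      have : ∃ t, ∀ x ∈ T, x ∈ L q.1 t := by
        clear hc
        induction T, hfin using Set.Finite.induction_on with
        | empty => exact ⟨0, by simp⟩
        | @insert x T _ _ ih =>
          obtain ⟨t, ht⟩ := ih ((Set.subset_insert _ _).trans hT)
          obtain ⟨s, hs⟩ := hex q.1 x (hT (Set.mem_insert _ _))
          refine ⟨max s t, fun y hy => ?_⟩
          rcases hy with rfl | hy
          · exact (hmono _ _ _ (le_max_left s t)).subset hs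
          · exact (hmono _ _ _ (le_max_right s t)).subset (ht y hy)
      obtain ⟨t, ht⟩ := this
      refine ⟨t, ?_⟩
      have h1 : T.encard ≤ ((L q.1 t).toFinset : Set X).encard :=
        Set.encard_le_encard fun x hx => by simpa using ht x hx
      rw [hc, Set.encard_coe_eq_coe_finsetCard, List.toFinset_card_of_nodup (hnd _ _)] at h1
      exact_mod_cast h1
    · rintro ⟨t, ht⟩
      exact le_trans (by exact_mod_cast ht) (length_le_encard (hnd q.1 t) (hsub q.1 t))

/-- The partial inverse of an injective computable function is partial recursive. -/
theorem exists_partrec_leftInverse {f : α → β} (hf : Computable f) (hinj : f.Injective) :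
    ∃ g : β →. α, Partrec g ∧ ∀ a, g (f a) = Part.some a := by
  have hp : REPred fun q : β × α => f q.2 = q.1 :=
    rePred_eq (hf.comp Computable.snd) Computable.fst
  obtain ⟨nth, hnth, H⟩ := exists_partrec_nth hp
  refine ⟨fun b => nth (b, 0), hnth.comp (Computable.id.pair (Computable.const 0)), fun a => ?_⟩
  have hs : {x | f x = f a} = {a} := by
    ext x
    simp [hinj.eq_iff]
  obtain ⟨i, hi, h⟩ := H (f a) a rfl 1 (by simp [hs])
  obtain rfl : i = 0 := by omega
  exact Part.eq_some_iff.2 h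

end Enumerability

/-! ### Self-delimiting codes -/

section Strings

theorem foldr_bit_bits (n : ℕ) : n.bits.foldr Nat.bit 0 = n := by
  induction n using Nat.binaryRec' with
  | zero => simp
  | bit b n h ih => rw [Nat.bits_append_bit _ _ h, List.foldr_cons, ih]

theorem bits_injective : Function.Injective Nat.bits := fun a b h => by
  rw [← foldr_bit_bits a, h, foldr_bit_bits]

theorem primrec_bits : Primrec Nat.bits := by
  have hg : Primrec₂ fun (_ : Unit) (l : List (List Bool)) =>
      if l.length = 0 then some [] else
        (l[l.length.div2]?).map fun b => l.length.bodd :: b := by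
    refine Primrec.ite (Primrec.eq.comp (Primrec.list_length.comp Primrec.snd)
      (Primrec.const 0)) (Primrec.const _) ?_
    refine Primrec.option_map (Primrec.list_getElem?.comp Primrec.snd
      (Primrec.nat_div2.comp (Primrec.list_length.comp Primrec.snd))) ?_
    exact Primrec.list_cons.comp (Primrec.nat_bodd.comp
      (Primrec.list_length.comp (Primrec.snd.comp Primrec.fst))) Primrec.snd
  have h := Primrec.nat_strong_rec (fun (_ : Unit) n => Nat.bits n) hg fun _ n => by
    rcases Nat.eq_zero_or_pos n with rfl | hn
    · simp
    · have hlt : n.div2 < n := by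
        rw [Nat.div2_val]
        omega
      have hb : n.bits = n.bodd :: n.div2.bits := by
        conv_lhs => rw [← Nat.bit_bodd_div2 n]
        refine Nat.bits_append_bit _ _ fun h0 => ?_
        by_contra hc
        have := Nat.bit_bodd_div2 n
        rw [h0, Bool.eq_false_of_not_eq_true hc] at this
        exact hn.ne this
      simp [hn.ne', hlt, hb]
  exact h.comp (Primrec.const ()) Primrec.id

theorem primrec_tuple : Primrec tuple := by
  have hbit : Primrec₂ fun (_ : List Bool) (b : Bool) => [true, b] :=
    Primrec.list_cons.comp (Primrec.const true)
      (Primrec.list_cons.comp Primrec.snd (Primrec.const []))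
  have hentry : Primrec fun x : List Bool => (x.flatMap fun b => [true, b]) ++ [false] :=
    Primrec.list_append.comp (Primrec.list_flatMap Primrec.id hbit) (Primrec.const [false])
  exact Primrec.list_flatMap Primrec.id (hentry.comp Primrec.snd).to₂

theorem tuple_cons (x : List Bool) (l : List (List Bool)) :
    tuple (x :: l) = (x.flatMap fun b => [true, b]) ++ false :: tuple l := by
  simp [tuple]

theorem entry_append_inj {x y r s : List Bool}
    (h : (x.flatMap fun b => [true, b]) ++ false :: r
      = (y.flatMap fun b => [true, b]) ++ false :: s) : x = y ∧ r = s := by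
  induction x generalizing y with
  | nil => cases y <;> simp_all
  | cons a x ih =>
    cases y with
    | nil => simp at h
    | cons b y =>
      simp only [List.flatMap_cons, List.cons_append, List.nil_append, List.cons.injEq,
        true_and] at h
      obtain ⟨rfl, h⟩ := h
      obtain ⟨rfl, rfl⟩ := ih h
      exact ⟨rfl, rfl⟩

theorem tuple_injective : Function.Injective tuple := by
  intro l
  induction l with
  | nil =>
    intro m h
    cases m with
    | nil => rfl
    | cons y m => simp [tuple] at h
  | cons x l ih =>
    intro m h
    cases m with
    | nil => simp [tuple] at h
    | cons y m =>
      rw [tuple_cons, tuple_cons] at h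
      obtain ⟨rfl, h'⟩ := entry_append_inj h
      rw [ih h']

/-- Tuples of a fixed number of strings form a prefix code. -/
theorem tuple_append_inj {l m : List (List Bool)} {r s : List Bool} (hlen : l.length = m.length)
    (h : tuple l ++ r = tuple m ++ s) : l = m ∧ r = s := by
  induction l generalizing m with
  | nil =>
    obtain rfl : m = [] := List.length_eq_zero_iff.1 hlen.symm
    exact ⟨rfl, by simpa [tuple] using h⟩
  | cons x l ih =>
    cases m with
    | nil => simp at hlen
    | cons y m =>
      rw [tuple_cons, tuple_cons] at h
      simp only [List.append_assoc, List.cons_append] at h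
      obtain ⟨rfl, h'⟩ := entry_append_inj h
      obtain ⟨rfl, rfl⟩ := ih (by simpa using hlen) h'
      exact ⟨rfl, rfl⟩

theorem length_tuple_pair (x y : List Bool) :
    (tuple [x, y]).length = 2 * x.length + 2 * y.length + 2 := by
  simp [tuple, List.length_flatMap]
  omega

/-- The program that consists of a parameter `m` and an index `i`, both self-delimiting, and of a
string `p`.  The index costs only a logarithmic term more than its binary length. -/
def describe (q : (ℕ × ℕ) × List Bool) : List Bool :=
  tuple [q.1.1.bits, q.1.2.size.bits] ++ (q.1.2.bits ++ q.2)

theorem describe_injective : Function.Injective describe := by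
  rintro ⟨⟨m, i⟩, p⟩ ⟨⟨n, j⟩, q⟩ h
  obtain ⟨h1, h2⟩ := tuple_append_inj (l := [m.bits, i.size.bits])
    (m := [n.bits, j.size.bits]) rfl h
  simp only [List.cons.injEq, and_true] at h1
  obtain rfl := bits_injective h1.1
  obtain ⟨h3, rfl⟩ := List.append_inj h2 (by
    simpa [Nat.size_eq_bits_len] using bits_injective h1.2)
  obtain rfl := bits_injective h3
  rfl

theorem length_describe (m i : ℕ) (p : List Bool) :
    (describe ((m, i), p)).length = p.length + i.size + 2 * i.size.size + 2 * m.size + 2 := by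
  simp only [describe, List.length_append, length_tuple_pair, Nat.size_eq_bits_len]
  omega

theorem computable_describe : Computable describe := by
  have hsize : Primrec Nat.size :=
    (Primrec.list_length.comp primrec_bits).of_eq Nat.size_eq_bits_len
  have hm : Primrec fun q : (ℕ × ℕ) × List Bool => q.1.1 := Primrec.fst.comp Primrec.fst
  have hi : Primrec fun q : (ℕ × ℕ) × List Bool => q.1.2 := Primrec.snd.comp Primrec.fst
  refine Primrec.to_comp (Primrec.list_append.comp (primrec_tuple.comp
    (Primrec.list_cons.comp (primrec_bits.comp hm) (Primrec.list_cons.comp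
      (primrec_bits.comp (hsize.comp hi)) (Primrec.const [])))) ?_)
  exact Primrec.list_append.comp (primrec_bits.comp hi) Primrec.snd

/-- There are fewer than `2 ^ (a + 1)` strings of length at most `a`. -/
theorem encard_length_le (a : ℕ) : {p : List Bool | p.length ≤ a}.encard ≤ 2 ^ (a + 1) := by
  -- read the string as a binary numeral with a leading digit one
  have hpos : ∀ l : List Bool, 0 < l.foldr Nat.bit 1 := fun l => by
    induction l with
    | nil => simp
    | cons c l ih => cases c <;> simp [Nat.bit_val, ih]
  have hinj : Function.Injective fun p : List Bool => p.foldr Nat.bit 1 := by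
    intro p
    induction p with
    | nil =>
      intro q h
      cases q with
      | nil => rfl
      | cons b q =>
        have := hpos q
        cases b <;> simp [Nat.bit_val] at h <;> omega
    | cons a p ih =>
      intro q h
      cases q with
      | nil =>
        have := hpos p
        cases a <;> simp [Nat.bit_val] at h <;> omega
      | cons b q =>
        have hab : a = b ∧ p.foldr Nat.bit 1 = q.foldr Nat.bit 1 := by
          cases a <;> cases b <;> simp [Nat.bit_val] at h ⊢ <;> omega
        rw [hab.1, ih hab.2]
  have hlt : ∀ p : List Bool, p.foldr Nat.bit 1 < 2 ^ (p.length + 1) := by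
    intro p
    induction p with
    | nil => simp
    | cons b p ih =>
      simp only [List.foldr_cons, List.length_cons, pow_succ] at ih ⊢
      cases b <;> (simp [Nat.bit_val]; omega)
  rw [← hinj.encard_image]
  refine (Set.encard_le_encard (t := ((Finset.range (2 ^ (a + 1)) : Finset ℕ) : Set ℕ)) ?_).trans
    (by rw [Set.encard_coe_eq_coe_finsetCard]; simp)
  rintro _ ⟨p, hp, rfl⟩
  simp only [Finset.coe_range, Set.mem_Iio]
  exact (hlt p).trans_le (Nat.pow_le_pow_right two_pos (Nat.succ_le_succ hp))

end Strings

/-! ### Bounds for Kolmogorov complexity -/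

/-- Counting pairs by their first component: `T` fibres with at least `k` elements each contain
at least `T.card * k` pairs. -/
theorem card_mul_le_encard {Y X : Type*} {S : Set (Y × X)} {k : ℕ∞} (T : Finset Y)
    (h : ∀ y ∈ T, k ≤ {x | (y, x) ∈ S}.encard) : T.card * k ≤ S.encard := by
  classical
  have key : T.card * k ≤ {q | q ∈ S ∧ q.1 ∈ T}.encard := by
    induction T using Finset.induction_on with
    | empty => simp
    | insert y T hy ih =>
      have hsub : (Prod.mk y '' {x | (y, x) ∈ S}) ∪ {q | q ∈ S ∧ q.1 ∈ T} ⊆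
          {q | q ∈ S ∧ q.1 ∈ insert y T} := by
        rintro q (⟨x, hx, rfl⟩ | hq)
        · exact ⟨hx, Finset.mem_insert_self _ _⟩
        · exact ⟨hq.1, Finset.mem_insert_of_mem hq.2⟩
      refine le_trans ?_ (Set.encard_le_encard hsub)
      rw [Set.encard_union_eq, (Prod.mk_right_injective y).encard_image,
        Finset.card_insert_of_notMem hy, Nat.cast_add, add_mul, add_comm, Nat.cast_one, one_mul]
      · exact add_le_add (h y (Finset.mem_insert_self _ _))
          (ih fun z hz => h z (Finset.mem_insert_of_mem hz))
      · rw [Set.disjoint_left]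
        rintro _ ⟨x, -, rfl⟩ hq
        exact hy hq.2
  exact key.trans (Set.encard_le_encard fun q hq => hq.1)

section Complexity

variable {U : ProgLang}

theorem complexity_le_length {x p : List Bool} (h : x ∈ U p []) : complexity U x ≤ p.length :=
  ENat.toNat_le_of_le_natCast (iInf₂_le p h)

theorem IsUniversal.exists_program (hU : IsUniversal U) (x : List Bool) :
    ∃ p, x ∈ U p [] ∧ p.length ≤ complexity U x := by
  have h : condComplexity U x [] < (complexity U x + 1 : ℕ) := by
    rw [← ENat.natCast_toNat (hU.condComplexity_ne_top x [])]
    exact_mod_cast Nat.lt_succ_self _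
  simp only [condComplexity, iInf_lt_iff] at h
  obtain ⟨p, hp, hlt⟩ := h
  exact ⟨p, hp, Nat.lt_succ_iff.1 (by exact_mod_cast hlt)⟩

theorem IsUniversal.complexity_le_iff (hU : IsUniversal U) {x : List Bool} {a : ℕ} :
    complexity U x ≤ a ↔ ∃ p, p.length ≤ a ∧ x ∈ U p [] := by
  constructor
  · intro h
    obtain ⟨p, hp, hl⟩ := hU.exists_program x
    exact ⟨p, hl.trans h, hp⟩
  · rintro ⟨p, hl, hp⟩
    exact (complexity_le_length hp).trans hl

/-- Complexity is upper semicomputable. -/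
theorem IsUniversal.rePred_complexity_le (hU : IsUniversal U) :
    REPred fun q : List Bool × ℕ => complexity U q.1 ≤ q.2 := by
  have hrun : Partrec fun p : List Bool => U p [] :=
    hU.partrec.comp Computable.id (Computable.const [])
  have h1 : REPred fun r : (List Bool × ℕ) × List Bool => r.1.1 ∈ U r.2 [] :=
    rePred_comp (rePred_mem hrun)
      (f := fun r : (List Bool × ℕ) × List Bool => (r.2, r.1.1))
      (Computable.snd.pair (Computable.fst.comp Computable.fst))
  have h2 : REPred fun r : (List Bool × ℕ) × List Bool => r.2.length ≤ r.1.2 := by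
    refine (rePred_of_computable (Primrec.nat_le.decide.comp
      (Primrec.list_length.comp Primrec.snd) (Primrec.snd.comp Primrec.fst)).to_comp).of_eq
      fun r => ?_
    simp
  exact (rePred_exists (rePred_and h2 h1)).of_eq fun q =>
    (hU.complexity_le_iff (x := q.1) (a := q.2)).symm

theorem IsUniversal.encard_complexity_le (hU : IsUniversal U) (a : ℕ) :
    {x | complexity U x ≤ a}.encard ≤ 2 ^ (a + 1) := by
  choose prog hprog hlen using hU.exists_program
  have hinj : Function.Injective prog := fun x y h => by
    have hx := hprog x
    rw [h] at hx
    exact Part.mem_unique hx (hprog y)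
  rw [← hinj.encard_image]
  refine (Set.encard_le_encard ?_).trans (encard_length_le a)
  rintro _ ⟨x, hx, rfl⟩
  exact (hlen x).trans hx

/-- Every effective injective coding of descriptions by programs bounds the complexity. -/
theorem IsUniversal.exists_complexity_le_length (hU : IsUniversal U) {β : Type*} [Primcodable β]
    {f : β →. List Bool} (hf : Partrec f) {e : β → List Bool} (he : Computable e)
    (hinj : e.Injective) : ∃ c, ∀ b, ∀ x ∈ f b, complexity U x ≤ (e b).length + c := by
  obtain ⟨inv, hinv, H⟩ := exists_partrec_leftInverse he hinj
  have hL : Partrec₂ fun (p _ : List Bool) => (inv p).bind f :=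
    (hinv.comp Computable.fst).bind (hf.comp Computable.snd)
  obtain ⟨c, hc⟩ := hU.optimal _ hL
  refine ⟨c, fun b x hx => ENat.toNat_le_of_le_natCast ((hc x []).trans ?_)⟩
  push_cast
  refine add_le_add_left (iInf₂_le (e b) ?_) _
  change x ∈ (inv (e b)).bind f
  exact Part.mem_bind (H b ▸ Part.mem_some b) hx

/-- An element of a set of at most `2 ^ s` elements that is effectively enumerated from `m` and `y`
is determined by `m`, `y` and its index in the enumeration.  The parameter `m` is meant to be small:
it is coded with twice its binary length.  The string coding `y` enters through its shortest
program, which ends the description and need not be delimited. -/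
theorem IsUniversal.exists_complexity_le_index (hU : IsUniversal U) {M Y X : Type*}
    [Primcodable M] [Primcodable Y] [Primcodable X] {e : Y → List Bool} (he : Computable e)
    (hinj : e.Injective) {p : (M × Y) × X → Prop} (hp : REPred p)
    {h : (M × Y) × X → List Bool} (hh : Computable h) :
    ∃ c, ∀ m y x s, p ((m, y), x) → {x | p ((m, y), x)}.encard ≤ 2 ^ s →
      complexity U (h ((m, y), x)) ≤
        complexity U (e y) + s + 2 * s.size + 2 * (Encodable.encode m).size + c := by
  obtain ⟨nth, hnth, Hnth⟩ := exists_partrec_nth hp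
  obtain ⟨inv, hinv, Hinv⟩ := exists_partrec_leftInverse he hinj
  let D := (M × ℕ) × List Bool
  have hrun : Partrec fun d : D => U d.2 [] :=
    hU.partrec.comp Computable.snd (Computable.const [])
  have hy : Partrec fun d : D => (U d.2 []).bind inv :=
    hrun.bind (hinv.comp Computable.snd)
  have hx : Partrec fun r : D × Y => (nth ((r.1.1.1, r.2), r.1.1.2)).map
      fun x => h ((r.1.1.1, r.2), x) := by
    refine Partrec.map (hnth.comp (((Computable.fst.comp (Computable.fst.comp
      Computable.fst)).pair Computable.snd).pair (Computable.snd.comp (Computable.fst.comp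
        Computable.fst)))) ?_
    exact hh.comp (((Computable.fst.comp (Computable.fst.comp (Computable.fst.comp
      Computable.fst))).pair (Computable.snd.comp Computable.fst)).pair Computable.snd)
  have hcode : Computable fun d : D => describe ((Encodable.encode d.1.1, d.1.2), d.2) :=
    computable_describe.comp (((Computable.encode.comp (Computable.fst.comp
      Computable.fst)).pair (Computable.snd.comp Computable.fst)).pair Computable.snd)
  have hcode_inj : Function.Injective
      fun d : D => describe ((Encodable.encode d.1.1, d.1.2), d.2) := by
    rintro ⟨⟨m, i⟩, r⟩ ⟨⟨n, j⟩, s⟩ hd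
    have := describe_injective hd
    simp only [Prod.mk.injEq, Encodable.encode_inj] at this
    obtain ⟨⟨rfl, rfl⟩, rfl⟩ := this
    rfl
  obtain ⟨c, hc⟩ := hU.exists_complexity_le_length (hy.bind hx.to₂) hcode hcode_inj
  refine ⟨c + 2, fun m y x s hmx hs => ?_⟩
  obtain ⟨i, hi, hxi⟩ := Hnth (m, y) x hmx (2 ^ s) (by simpa using hs)
  obtain ⟨r, hr, hlen⟩ := hU.exists_program (e y)
  have hsize : i.size ≤ s := Nat.size_le.2 hi
  have hbound := hc ((m, i), r) (h ((m, y), x)) ?_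
  · dsimp only at hbound
    rw [length_describe] at hbound
    have := Nat.size_le_size hsize
    omega
  · refine Part.mem_bind (Part.mem_bind hr ?_) (Part.mem_map _ hxi)
    rw [Hinv]
    exact Part.mem_some _

/-- A computable map increases complexity by at most a constant. -/
theorem IsUniversal.exists_complexity_comp_le (hU : IsUniversal U) {Y : Type*} [Primcodable Y]
    {e : Y → List Bool} (he : Computable e) (hinj : e.Injective) {f : Y → List Bool}
    (hf : Computable f) : ∃ c, ∀ y, complexity U (f y) ≤ complexity U (e y) + c := by
  obtain ⟨c, hc⟩ := hU.exists_complexity_le_index (M := Unit) (X := Unit) he hinj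
    (p := fun _ => True) ((rePred_of_computable (Computable.const true)).of_eq fun _ => by simp)
    (hf.comp (Computable.snd.comp Computable.fst))
  refine ⟨c, fun y => ?_⟩
  simpa using hc () y () 0 trivial (by simp)

/-- If a finite effectively enumerated set of pairs `(y, x)` has many elements with the first
component `y`, then `y` is simple: there are few such `y`, and they can be enumerated. -/
theorem IsUniversal.exists_complexity_add_le_of_encard (hU : IsUniversal U) {M Z Y X : Type*}
    [Primcodable M] [Primcodable Z] [Primcodable Y] [Primcodable X] {e : Z → List Bool}
    (he : Computable e) (hinj : e.Injective) {p : (M × Z) × (Y × X) → Prop} (hp : REPred p)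
    {h : (M × Z) × Y → List Bool} (hh : Computable h) :
    ∃ c, ∀ m z y γ r, 2 ^ γ ≤ {x | p ((m, z), (y, x))}.encard →
      {q | p ((m, z), q)}.encard ≤ 2 ^ r →
      complexity U (h ((m, z), y)) + γ ≤
        complexity U (e z) + r + 2 * r.size + 2 * (Encodable.encode (m, γ)).size + c := by
  have hfib : REPred fun q : ((M × Z) × Y) × X => p (q.1.1, (q.1.2, q.2)) :=
    rePred_comp hp ((Computable.fst.comp Computable.fst).pair
      ((Computable.snd.comp Computable.fst).pair Computable.snd))
  have hpow : Computable fun n : ℕ => 2 ^ n := by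
    refine ((Primrec.nat_rec₁ (f := fun _ n => 2 * n) 1
      (Primrec.nat_double.comp Primrec.snd).to₂).of_eq fun n => ?_).to_comp
    induction n with
    | zero => rfl
    | succ n ih => rw [pow_succ', ← ih]
  have hheavy : REPred fun q : ((M × ℕ) × Z) × Y =>
      ((2 ^ q.1.1.2 : ℕ) : ℕ∞) ≤ {x | p ((q.1.1.1, q.1.2), (q.2, x))}.encard := by
    refine rePred_comp (rePred_le_encard hfib)
      (f := fun q : ((M × ℕ) × Z) × Y => (((q.1.1.1, q.1.2), q.2), 2 ^ q.1.1.2)) ?_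
    have h1 : Computable fun q : ((M × ℕ) × Z) × Y => q.1.1 := Computable.fst.comp Computable.fst
    exact (((Computable.fst.comp h1).pair (Computable.snd.comp Computable.fst)).pair
      Computable.snd).pair (hpow.comp (Computable.snd.comp h1))
  obtain ⟨c, hc⟩ := hU.exists_complexity_le_index he hinj hheavy
    (h := fun q => h ((q.1.1.1, q.1.2), q.2))
    (hh.comp (((Computable.fst.comp (Computable.fst.comp Computable.fst)).pair
      (Computable.snd.comp Computable.fst)).pair Computable.snd))
  refine ⟨c, fun m z y γ r hγ hr => ?_⟩
  have hfibre : ∀ y', {x | p ((m, z), (y', x))}.encard ≤ 2 ^ r := fun y' => by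
    refine le_trans ?_ hr
    rw [← (Prod.mk_right_injective y').encard_image]
    exact Set.encard_le_encard (by rintro _ ⟨x, hx, rfl⟩; exact hx)
  have hγr : γ ≤ r := by
    have : ((2 ^ γ : ℕ) : ℕ∞) ≤ ((2 ^ r : ℕ) : ℕ∞) := by
      push_cast
      exact hγ.trans (hfibre y)
    exact (Nat.pow_le_pow_iff_right one_lt_two).1 (by exact_mod_cast this)
  have hcount : {y' | ((2 ^ γ : ℕ) : ℕ∞) ≤ {x | p ((m, z), (y', x))}.encard}.encard
      ≤ 2 ^ (r - γ) := by
    -- one more element than allowed would give more than `2 ^ r` pairs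
    by_contra hcon
    obtain ⟨T, hT, hcard⟩ := Set.exists_subset_encard_eq (Order.add_one_le_of_lt (not_le.1 hcon))
    have hfin : T.Finite := Set.finite_of_encard_eq_coe (k := 2 ^ (r - γ) + 1)
      (by rw [hcard]; norm_cast)
    have h1 := card_mul_le_encard (S := {q | p ((m, z), q)}) hfin.toFinset
      fun y hy => hT (hfin.mem_toFinset.1 hy)
    have h2 : hfin.toFinset.card = 2 ^ (r - γ) + 1 := by
      rw [hfin.encard_eq_coe_toFinset_card] at hcard
      exact_mod_cast hcard
    have h3 : (2 ^ (r - γ) + 1) * 2 ^ γ ≤ 2 ^ r := by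
      have := h1.trans hr
      rw [h2] at this
      exact_mod_cast this
    have h4 : 2 ^ (r - γ) * 2 ^ γ = 2 ^ r := by rw [← pow_add, Nat.sub_add_cancel hγr]
    have h5 : 0 < 2 ^ γ := by positivity
    rw [add_mul, h4] at h3
    omega
  have := hc (m, γ) z y (r - γ) (by push_cast; exact hγ) hcount
  have := Nat.size_le_size (Nat.sub_le r γ)
  dsimp only at *
  omega

end Complexity

/-! ### Points and lines with an enumerable incidence relation -/

section Incidence

theorem size_pair_le {x y l : ℕ} (hx : x.size ≤ l) (hy : y.size ≤ l) :
    (Nat.pair x y).size ≤ 2 * l := by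
  rw [Nat.size_le] at *
  refine (Nat.pair_lt_max_add_one_sq x y).trans_le ?_
  rw [mul_comm, pow_mul]
  exact Nat.pow_le_pow_left (Nat.succ_le_of_lt (max_lt hx hy)) 2

/-- At least half of the pairs in a product of two finite sets are off the diagonal, as soon as
one of them is: the diagonal has at most as many elements as the smaller factor. -/
theorem ncard_mul_ncard_le_offDiag {X : Type*} {S T : Set X} (hS : S.Finite) (hT : T.Finite)
    {x y : X} (hx : x ∈ S) (hy : y ∈ T) (hxy : x ≠ y) :
    S.ncard * T.ncard ≤ 2 * {q : X × X | q.1 ≠ q.2 ∧ q.1 ∈ S ∧ q.2 ∈ T}.ncard := by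
  classical
  lift S to Finset X using hS
  lift T to Finset X using hT
  have hset : {q : X × X | q.1 ≠ q.2 ∧ q.1 ∈ (S : Set X) ∧ q.2 ∈ (T : Set X)}
      = (((S ×ˢ T).filter fun q => q.1 ≠ q.2 : Finset (X × X)) : Set (X × X)) := by
    ext q
    simp [and_comm]
  rw [hset, Set.ncard_coe_finset, Set.ncard_coe_finset, Set.ncard_coe_finset,
    ← Finset.card_product]
  have hsplit := Finset.card_filter_add_card_filter_not (s := S ×ˢ T) fun q : X × X => q.1 ≠ q.2
  have hdS : ((S ×ˢ T).filter fun q : X × X => ¬ q.1 ≠ q.2).card ≤ S.card := by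
    refine Finset.card_le_card_of_injOn Prod.fst ?_ ?_
    · intro q hq
      exact (Finset.mem_product.1 (Finset.mem_filter.1 hq).1).1
    · rintro ⟨a, b⟩ hq ⟨a', b'⟩ hq' h
      simp_all
  have hdT : ((S ×ˢ T).filter fun q : X × X => ¬ q.1 ≠ q.2).card ≤ T.card := by
    refine Finset.card_le_card_of_injOn Prod.snd ?_ ?_
    · intro q hq
      exact (Finset.mem_product.1 (Finset.mem_filter.1 hq).1).2
    · rintro ⟨a, b⟩ hq ⟨a', b'⟩ hq' h
      simp_all
  have hpos : 0 < ((S ×ˢ T).filter fun q : X × X => q.1 ≠ q.2).card :=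
    Finset.card_pos.2 ⟨(x, y), Finset.mem_filter.2 ⟨Finset.mem_product.2 ⟨hx, hy⟩, hxy⟩⟩
  have hSpos : 0 < S.card := Finset.card_pos.2 ⟨x, hx⟩
  have hTpos : 0 < T.card := Finset.card_pos.2 ⟨y, hy⟩
  rw [Finset.card_product] at *
  rcases Nat.lt_or_ge S.card 2 with h1 | h1
  · rcases Nat.lt_or_ge T.card 2 with h2 | h2
    · have h3 : S.card = 1 := by omega
      have h4 : T.card = 1 := by omega
      rw [h3, h4] at *
      omega
    · nlinarith
  · nlinarith

variable {U : ProgLang}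

theorem primrec_tuple_two {α : Type*} [Primcodable α] {f g : α → List Bool} (hf : Primrec f)
    (hg : Primrec g) : Primrec fun a => tuple [f a, g a] :=
  primrec_tuple.comp (Primrec.list_cons.comp hf (Primrec.list_cons.comp hg (Primrec.const [])))

theorem primrec_tuple_three {α : Type*} [Primcodable α] {f g h : α → List Bool} (hf : Primrec f)
    (hg : Primrec g) (hh : Primrec h) : Primrec fun a => tuple [f a, g a, h a] :=
  primrec_tuple.comp (Primrec.list_cons.comp hf (Primrec.list_cons.comp hg
    (Primrec.list_cons.comp hh (Primrec.const []))))

theorem tuple_two_injective :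
    Function.Injective fun q : List Bool × List Bool => tuple [q.1, q.2] := by
  rintro ⟨x, y⟩ ⟨x', y'⟩ h
  have := tuple_injective h
  simp_all

theorem IsUniversal.encard_tupleComplexity_le (hU : IsUniversal U) (a : ℕ) :
    {q : List Bool × List Bool | tupleComplexity U [q.1, q.2] ≤ a}.encard ≤ 2 ^ (a + 1) := by
  rw [← tuple_two_injective.encard_image]
  refine (Set.encard_le_encard ?_).trans (hU.encard_complexity_le a)
  rintro _ ⟨q, hq, rfl⟩
  exact hq

/-- If two distinct points determine a line and incidence is recursively enumerable, then, for a
line `C` with distinct points `A` and `B`,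
`K(A, C, D) + K(B, C, D) + K(D) ≤ K(A, D) + K(B, D) + K(C, D)` up to a logarithmic term.

The points of `C` that are as simple as `A` relative to `D`, paired with those that are as simple as
`B`, give pairs which do not occur for any other line; hence there are few lines
with as many pairs as `C`. -/
theorem IsUniversal.exists_complexity_incidence_le (hU : IsUniversal U)
    {Inc : ℕ × (List Bool × List Bool) → Prop} (hInc : REPred Inc) :
    ∃ c, ∀ (n : ℕ) (A B C D : List Bool),
      (∀ P Q l l', P ≠ Q → Inc (n, (P, l)) → Inc (n, (Q, l)) → Inc (n, (P, l')) →
        Inc (n, (Q, l')) → l = l') →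
      Inc (n, (A, C)) → Inc (n, (B, C)) → A ≠ B →
      tupleComplexity U [C, D, A] + tupleComplexity U [C, D, B] + complexity U D ≤
        tupleComplexity U [C, D] + tupleComplexity U [D, A] + tupleComplexity U [D, B] +
          42 * (n + tupleComplexity U [D, A] + tupleComplexity U [D, B] + 4).size + c := by
  -- the points of the line that are simple relative to `D`
  have hsimple : REPred fun q : (List Bool × List Bool) × ℕ =>
      tupleComplexity U [q.1.1, q.1.2] ≤ q.2 :=
    rePred_comp hU.rePred_complexity_le
      (f := fun q : (List Bool × List Bool) × ℕ => (tuple [q.1.1, q.1.2], q.2))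
      ((primrec_tuple_two (Primrec.fst.comp Primrec.fst)
        (Primrec.snd.comp Primrec.fst)).pair Primrec.snd).to_comp
  have hp1 : REPred fun q : ((ℕ × ℕ) × (List Bool × List Bool)) × List Bool =>
      Inc (q.1.1.1, (q.2, q.1.2.1)) ∧ tupleComplexity U [q.1.2.2, q.2] ≤ q.1.1.2 := by
    have hna : Primrec fun q : ((ℕ × ℕ) × (List Bool × List Bool)) × List Bool => q.1.1 :=
      Primrec.fst.comp Primrec.fst
    have hCD : Primrec fun q : ((ℕ × ℕ) × (List Bool × List Bool)) × List Bool => q.1.2 :=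
      Primrec.snd.comp Primrec.fst
    exact rePred_and
      (rePred_comp hInc
        (f := fun q : ((ℕ × ℕ) × (List Bool × List Bool)) × List Bool =>
          (q.1.1.1, (q.2, q.1.2.1)))
        ((Primrec.fst.comp hna).pair (Primrec.snd.pair (Primrec.fst.comp hCD))).to_comp)
      (rePred_comp hsimple
        (f := fun q : ((ℕ × ℕ) × (List Bool × List Bool)) × List Bool =>
          ((q.1.2.2, q.2), q.1.1.2))
        (((Primrec.snd.comp hCD).pair Primrec.snd).pair (Primrec.snd.comp hna)).to_comp)
  obtain ⟨c₁, h₁⟩ := hU.exists_complexity_le_index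
    (primrec_tuple_two Primrec.fst Primrec.snd).to_comp tuple_two_injective hp1
    (h := fun q => tuple [q.1.2.1, q.1.2.2, q.2])
    (primrec_tuple_three (Primrec.fst.comp (Primrec.snd.comp Primrec.fst))
      (Primrec.snd.comp (Primrec.snd.comp Primrec.fst)) Primrec.snd).to_comp
  -- all pairs of bounded complexity, as a relation between `D` and a point
  have hp2 : REPred fun q : (ℕ × Unit) × (List Bool × List Bool) =>
      tupleComplexity U [q.2.1, q.2.2] ≤ q.1.1 :=
    rePred_comp hsimple (f := fun q : (ℕ × Unit) × (List Bool × List Bool) => (q.2, q.1.1))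
      (Primrec.snd.pair (Primrec.fst.comp Primrec.fst)).to_comp
  obtain ⟨c₂, h₂⟩ := hU.exists_complexity_add_le_of_encard (e := fun _ : Unit => [])
    (Computable.const []) (fun _ _ _ => rfl) hp2 (h := fun q => q.2) Computable.snd
  -- two distinct points of a line, both simple relative to `D`
  have hp3 : REPred fun q : ((ℕ × (ℕ × ℕ)) × List Bool) ×
      (List Bool × (List Bool × List Bool)) =>
      (q.2.2.1 ≠ q.2.2.2) ∧
      (Inc (q.1.1.1, (q.2.2.1, q.2.1)) ∧ tupleComplexity U [q.1.2, q.2.2.1] ≤ q.1.1.2.1) ∧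
      (Inc (q.1.1.1, (q.2.2.2, q.2.1)) ∧ tupleComplexity U [q.1.2, q.2.2.2] ≤ q.1.1.2.2) := by
    let Q := ((ℕ × (ℕ × ℕ)) × List Bool) × (List Bool × (List Bool × List Bool))
    have hn : Primrec fun q : Q => q.1.1.1 := Primrec.fst.comp (Primrec.fst.comp Primrec.fst)
    have hab : Primrec fun q : Q => q.1.1.2 := Primrec.snd.comp (Primrec.fst.comp Primrec.fst)
    have hD : Primrec fun q : Q => q.1.2 := Primrec.snd.comp Primrec.fst
    have hC : Primrec fun q : Q => q.2.1 := Primrec.fst.comp Primrec.snd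
    have hA : Primrec fun q : Q => q.2.2.1 := Primrec.fst.comp (Primrec.snd.comp Primrec.snd)
    have hB : Primrec fun q : Q => q.2.2.2 := Primrec.snd.comp (Primrec.snd.comp Primrec.snd)
    have hone : ∀ {A : Q → List Bool} {a : Q → ℕ}, Primrec A → Primrec a → REPred fun q : Q =>
        Inc (q.1.1.1, (A q, q.2.1)) ∧ tupleComplexity U [q.1.2, A q] ≤ a q := fun hA ha =>
      rePred_and
        (rePred_comp hInc (f := fun q : Q => (q.1.1.1, (_, q.2.1)))
          (hn.pair (hA.pair hC)).to_comp)
        (rePred_comp hsimple (f := fun q : Q => ((q.1.2, _), _)) ((hD.pair hA).pair ha).to_comp)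
    refine rePred_and ?_ (rePred_and (hone hA (Primrec.fst.comp hab))
      (hone hB (Primrec.snd.comp hab)))
    refine (rePred_of_computable (Primrec.not.comp (Primrec.eq.decide.comp hA hB)).to_comp).of_eq
      fun q => ?_
    simp
  obtain ⟨c₃, h₃⟩ := hU.exists_complexity_add_le_of_encard (e := fun D : List Bool => D)
    Computable.id Function.injective_id hp3 (h := fun q => tuple [q.2, q.1.2])
    (primrec_tuple_two Primrec.snd (Primrec.snd.comp Primrec.fst)).to_comp
  refine ⟨2 * c₁ + 2 * c₂ + c₃ + 2 * complexity U [] + 7, fun n A B C D huniq hA hB hAB => ?_⟩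
  set a := tupleComplexity U [D, A] with ha
  set b := tupleComplexity U [D, B] with hb
  set l := (n + a + b + 4).size with hl
  let T : ℕ → Set (List Bool) := fun a => {P | tupleComplexity U [D, P] ≤ a}
  let S : ℕ → Set (List Bool) := fun a => {P | Inc (n, (P, C)) ∧ tupleComplexity U [D, P] ≤ a}
  have hTcard : ∀ a, (T a).encard ≤ 2 ^ (a + 1) := fun a => by
    refine le_trans ?_ (hU.encard_tupleComplexity_le a)
    rw [← (Prod.mk_right_injective D).encard_image]
    exact Set.encard_le_encard (by rintro _ ⟨P, hP, rfl⟩; exact hP)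
  have hTfin : ∀ a, (T a).Finite := fun a =>
    Set.finite_of_encard_le_coe (k := 2 ^ (a + 1)) (by simpa using hTcard a)
  have hST : ∀ a, S a ⊆ T a := fun a P hP => hP.2
  have hSfin : ∀ a, (S a).Finite := fun a => (hTfin a).subset (hST a)
  have hlT : ∀ a, (T a).ncard < 2 ^ (T a).ncard.size := fun a => Nat.lt_size_self _
  have hlS : ∀ a, (S a).ncard < 2 ^ (S a).ncard.size := fun a => Nat.lt_size_self _
  have hpow : ∀ m : ℕ, 0 < m → 2 ^ (m.size - 1) ≤ m := fun m hm =>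
    Nat.lt_size.1 (Nat.sub_lt (Nat.size_pos.2 hm) one_pos)
  have hsizeT : ∀ a, (T a).ncard.size ≤ a + 2 := fun a => by
    rw [Nat.size_le]
    have h := hTcard a
    rw [← (hTfin a).cast_ncard_eq] at h
    have h : (T a).ncard ≤ 2 ^ (a + 1) := by exact_mod_cast h
    exact h.trans_lt (Nat.pow_lt_pow_right one_lt_two (Nat.lt_succ_self _))
  have hsizeST : ∀ a, (S a).ncard.size ≤ (T a).ncard.size := fun a =>
    Nat.size_le_size (Set.ncard_le_ncard (hST a) (hTfin a))
  have hle : ∀ m, m ≤ n + a + b + 4 → m.size ≤ l := fun m hm => Nat.size_le_size hm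
  -- the description of the point `P`, given `C` and `D`
  have hpoint : ∀ P a', Inc (n, (P, C)) → tupleComplexity U [D, P] = a' → a' + 4 ≤ n + a + b + 4 →
      tupleComplexity U [C, D, P] ≤
        tupleComplexity U [C, D] + (S a').ncard.size + 6 * l + c₁ := by
    intro P a' hP hPa ha'
    have h := h₁ (n, a') (C, D) P (S a').ncard.size ⟨hP, hPa.le⟩ (by
      rw [← (hSfin a').cast_ncard_eq (s := S a')]
      exact_mod_cast (hlS a').le)
    have h1 := hle _ (((hsizeST a').trans (hsizeT a')).trans (by omega : a' + 2 ≤ n + a + b + 4))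
    have h2 := size_pair_le (hle n (by omega)) (hle a' (by omega))
    simp only [Encodable.encode_prod_val, Encodable.encode_nat] at h
    simp only [tupleComplexity] at *
    omega
  -- `D` is one of the few strings with as many simple points
  have hD : ∀ P a', tupleComplexity U [D, P] = a' → a' + 4 ≤ n + a + b + 4 →
      complexity U D + ((T a').ncard.size - 1) ≤ complexity U [] + a' + 1 + 6 * l + c₂ := by
    intro P a' hPa ha'
    have hpos : 0 < (T a').ncard :=
      (Set.ncard_pos (hTfin a')).2 ⟨P, hPa.le⟩
    have h := h₂ a' () D ((T a').ncard.size - 1) (a' + 1) (by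
      rw [← (hTfin a').cast_ncard_eq (s := T a')]
      exact_mod_cast hpow _ hpos) (hU.encard_tupleComplexity_le a')
    have h1 := hle (a' + 1) (by omega)
    have h2 := size_pair_le (hle a' (by omega)) (hle ((T a').ncard.size - 1) (by
      have := hsizeT a'
      omega))
    simp only [Encodable.encode_prod_val, Encodable.encode_nat] at h
    omega
  -- `C` is one of the few lines with as many pairs of simple points
  have hC : tupleComplexity U [C, D] + ((S a).ncard.size + (S b).ncard.size - 3) ≤
      complexity U D + ((T a).ncard.size + (T b).ncard.size) + 18 * l + c₃ := by
    have hAS : A ∈ S a := ⟨hA, le_rfl⟩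
    have hBS : B ∈ S b := ⟨hB, le_rfl⟩
    have hSa : 0 < (S a).ncard := (Set.ncard_pos (hSfin a)).2 ⟨A, hAS⟩
    have hSb : 0 < (S b).ncard := (Set.ncard_pos (hSfin b)).2 ⟨B, hBS⟩
    have hpairs := ncard_mul_ncard_le_offDiag (hSfin a) (hSfin b) hAS hBS hAB
    set O := {q : List Bool × List Bool | q.1 ≠ q.2 ∧ q.1 ∈ S a ∧ q.2 ∈ S b} with hO
    have hOfin : O.Finite := ((hSfin a).prod (hSfin b)).subset fun q hq => ⟨hq.2.1, hq.2.2⟩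
    have hOcard : 2 ^ ((S a).ncard.size + (S b).ncard.size - 3) ≤ O.ncard := by
      have hs1 := Nat.size_pos.2 hSa
      have hs2 := Nat.size_pos.2 hSb
      -- the subtraction is truncated only if both sets are singletons
      rcases Nat.lt_or_ge ((S a).ncard.size + (S b).ncard.size) 3 with h3 | h3
      · rw [Nat.sub_eq_zero_of_le h3.le, pow_zero]
        exact (Set.ncard_pos hOfin).2 ⟨(A, B), hAB, hAS, hBS⟩
      · have h4 := Nat.mul_le_mul (hpow _ hSa) (hpow _ hSb)
        rw [← pow_add, show (S a).ncard.size - 1 + ((S b).ncard.size - 1)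
          = (S a).ncard.size + (S b).ncard.size - 3 + 1 by omega, pow_succ] at h4
        omega
    have h := h₃ (n, (a, b)) D C ((S a).ncard.size + (S b).ncard.size - 3)
      ((T a).ncard.size + (T b).ncard.size) (by
        change _ ≤ O.encard
        rw [← hOfin.cast_ncard_eq]
        exact_mod_cast hOcard) (by
        -- a pair of distinct points occurs for one line only
        have hinj : Set.InjOn (Prod.snd : List Bool × (List Bool × List Bool) → _)
            {q | q.2.1 ≠ q.2.2 ∧
              (Inc (n, (q.2.1, q.1)) ∧ tupleComplexity U [D, q.2.1] ≤ a) ∧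
              (Inc (n, (q.2.2, q.1)) ∧ tupleComplexity U [D, q.2.2] ≤ b)} := by
          rintro ⟨l₁, P, Q⟩ h1 ⟨l₂, P', Q'⟩ h2 h3
          obtain ⟨rfl, rfl⟩ := Prod.mk.inj h3
          rw [huniq P Q l₁ l₂ h1.1 h1.2.1.1 h1.2.2.1 h2.2.1.1 h2.2.2.1]
        rw [← hinj.encard_image]
        refine (Set.encard_le_encard (t := T a ×ˢ T b) ?_).trans ?_
        · rintro _ ⟨q, hq, rfl⟩
          exact ⟨hq.2.1.2, hq.2.2.2⟩
        · rw [← ((hTfin a).prod (hTfin b)).cast_ncard_eq, Set.ncard_prod, pow_add]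
          exact_mod_cast Nat.mul_le_mul (hlT a).le (hlT b).le)
    have hta := hsizeT a
    have htb := hsizeT b
    have hsa := hsizeST a
    have hsb := hsizeST b
    have h1 := hle ((T a).ncard.size + (T b).ncard.size) (by omega)
    have h2 := hle ((S a).ncard.size + (S b).ncard.size - 3) (by omega)
    have h4 : (Nat.pair (Nat.pair n (Nat.pair a b))
        ((S a).ncard.size + (S b).ncard.size - 3)).size ≤ 2 * (2 * (2 * l)) :=
      size_pair_le (size_pair_le ((hle n (by omega)).trans (by omega))
        (size_pair_le (hle a (by omega)) (hle b (by omega)))) (h2.trans (by omega))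
    simp only [Encodable.encode_prod_val, Encodable.encode_nat] at h
    simp only [tupleComplexity] at *
    omega
  have e1 := hpoint A a hA rfl (by omega)
  have e2 := hpoint B b hB rfl (by omega)
  have e3 := hD A a rfl (by omega)
  have e4 := hD B b rfl (by omega)
  omega

end Incidence

/-! ### The affine plane on strings -/

section AffinePlane

theorem Line.incident_unique {F : Type*} [Field F] {P Q : F × F} (hPQ : P ≠ Q) {l m : Line F}
    (hPl : l.Incident P) (hQl : l.Incident Q) (hPm : m.Incident P) (hQm : m.Incident Q) :
    l = m := by
  obtain ⟨x, y⟩ := P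
  obtain ⟨x', y'⟩ := Q
  cases l <;> cases m <;> simp only [Line.Incident] at hPl hQl hPm hQm
  case slanted.slanted a b a' b' =>
    have hx : x - x' ≠ 0 := fun h => by
      obtain rfl := sub_eq_zero.1 h
      exact hPQ (by rw [← hPl, ← hQl])
    have ha : a = a' := by
      refine sub_eq_zero.1 ((mul_eq_zero.1 (?_ : (a - a') * (x - x') = 0)).resolve_right hx)
      linear_combination hPl - hQl - hPm + hQm
    subst ha
    have hb : b = b' := by linear_combination hPl - hPm
    rw [hb]
  case slanted.vertical a b c =>
    subst hPm hQm
    exact absurd (by rw [← hPl, ← hQl]) hPQ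
  case vertical.slanted c a b =>
    subst hPl hQl
    exact absurd (by rw [← hPm, ← hQm]) hPQ
  case vertical.vertical c c' => rw [← hPl, ← hPm]

theorem Line.encard_incident_le {F : Type*} [Field F] (l : Line F) :
    {P | l.Incident P}.encard ≤ ENat.card F := by
  rw [← Set.encard_univ]
  cases l with
  | slanted a b =>
    refine le_trans (Set.encard_le_encard ?_)
      (Set.encard_image_le (fun x : F => (x, a * x + b)) Set.univ)
    rintro ⟨x, y⟩ h
    exact ⟨x, trivial, Prod.ext rfl h⟩
  | vertical c =>
    refine le_trans (Set.encard_le_encard ?_)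
      (Set.encard_image_le (fun y : F => (c, y)) Set.univ)
    rintro ⟨x, y⟩ h
    exact ⟨y, trivial, Prod.ext (Eq.symm h) rfl⟩

variable {enc : ∀ n : ℕ, GaloisField 2 n → List Bool}

theorem IsEffectiveEncoding.length_eq (henc : IsEffectiveEncoding enc) {n : ℕ} (hn : 1 ≤ n)
    (x : GaloisField 2 n) : (enc n x).length = n :=
  (henc.bijOn n hn).mapsTo (Set.mem_univ x)

theorem IsEffectiveEncoding.injective (henc : IsEffectiveEncoding enc) {n : ℕ} (hn : 1 ≤ n) :
    Function.Injective (enc n) :=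
  Set.injOn_univ.1 (henc.bijOn n hn).injOn

theorem IsEffectiveEncoding.exists_eq (henc : IsEffectiveEncoding enc) {n : ℕ} (hn : 1 ≤ n)
    {s : List Bool} (hs : s.length = n) : ∃ x, enc n x = s := by
  obtain ⟨x, -, hx⟩ := (henc.bijOn n hn).surjOn hs
  exact ⟨x, hx⟩

theorem IsEffectiveEncoding.append_inj (henc : IsEffectiveEncoding enc) {n : ℕ} (hn : 1 ≤ n)
    {x y x' y' : GaloisField 2 n} (h : enc n x ++ enc n y = enc n x' ++ enc n y') :
    x = x' ∧ y = y' := by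
  obtain ⟨h1, h2⟩ := List.append_inj h
    ((henc.length_eq hn x).trans (henc.length_eq hn x').symm)
  exact ⟨henc.injective hn h1, henc.injective hn h2⟩

theorem IsEffectiveEncoding.pointString_injective (henc : IsEffectiveEncoding enc) {n : ℕ}
    (hn : 1 ≤ n) : Function.Injective (pointString (enc n)) := fun P Q h => by
  obtain ⟨h1, h2⟩ := henc.append_inj hn h
  exact Prod.ext h1 h2

theorem IsEffectiveEncoding.lineString_injective (henc : IsEffectiveEncoding enc) {n : ℕ}
    (hn : 1 ≤ n) : Function.Injective (lineString (enc n)) := fun l m h => by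
  cases l <;> cases m <;> simp only [lineString, List.cons.injEq, reduceCtorEq, false_and,
    true_and] at h
  · obtain ⟨h1, h2⟩ := henc.append_inj hn h
    rw [h1, h2]
  · rw [henc.injective hn h]

theorem IsEffectiveEncoding.length_pointString (henc : IsEffectiveEncoding enc) {n : ℕ}
    (hn : 1 ≤ n) (P : GaloisField 2 n × GaloisField 2 n) :
    (pointString (enc n) P).length = 2 * n := by
  simp [pointString, henc.length_eq hn, two_mul]

theorem IsEffectiveEncoding.length_lineString_le (henc : IsEffectiveEncoding enc) {n : ℕ}
    (hn : 1 ≤ n) (l : Line (GaloisField 2 n)) : (lineString (enc n) l).length ≤ 2 * n + 1 := by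
  cases l <;> simp [lineString, henc.length_eq hn] <;> omega

/-- The incidence relation of the planes over the fields with `2 ^ n` elements, `n ≥ 1`, on the
strings of points and lines: `IncidentStrings enc (n, (A, C))` says that `A` and `C` represent a
point and a line of the plane number `n` that are incident. -/
def IncidentStrings (enc : ∀ n : ℕ, GaloisField 2 n → List Bool)
    (q : ℕ × (List Bool × List Bool)) : Prop :=
  1 ≤ q.1 ∧ ∃ (P : GaloisField 2 q.1 × GaloisField 2 q.1) (l : Line (GaloisField 2 q.1)),
    l.Incident P ∧ pointString (enc q.1) P = q.2.1 ∧ lineString (enc q.1) l = q.2.2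

theorem IsEffectiveEncoding.rePred_incidentStrings (henc : IsEffectiveEncoding enc) :
    REPred (IncidentStrings enc) := by
  obtain ⟨add, hadd, Hadd⟩ := henc.add
  obtain ⟨mul, hmul, Hmul⟩ := henc.mul
  -- a witness consists of the type of the line, the coordinates of the point, and the parameters
  -- of the line, the second of which is a dummy if the line is vertical
  let W := Bool × (List Bool × List Bool) × (List Bool × List Bool)
  let Q := (ℕ × (List Bool × List Bool)) × W
  have hn : Computable fun q : Q => q.1.1 := Computable.fst.comp Computable.fst
  have hA : Computable fun q : Q => q.1.2.1 :=
    Computable.fst.comp (Computable.snd.comp Computable.fst)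
  have hC : Computable fun q : Q => q.1.2.2 :=
    Computable.snd.comp (Computable.snd.comp Computable.fst)
  have hb : Computable fun q : Q => q.2.1 := Computable.fst.comp Computable.snd
  have hxy : Computable fun q : Q => q.2.2.1 :=
    Computable.fst.comp (Computable.snd.comp Computable.snd)
  have hcd : Computable fun q : Q => q.2.2.2 :=
    Computable.snd.comp (Computable.snd.comp Computable.snd)
  have hx : Computable fun q : Q => q.2.2.1.1 := Computable.fst.comp hxy
  have hy : Computable fun q : Q => q.2.2.1.2 := Computable.snd.comp hxy
  have hc : Computable fun q : Q => q.2.2.2.1 := Computable.fst.comp hcd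
  have hd : Computable fun q : Q => q.2.2.2.2 := Computable.snd.comp hcd
  have hlen : ∀ {u : Q → List Bool}, Computable u → REPred fun q : Q => (u q).length = q.1.1 :=
    fun hu => rePred_eq (Computable.list_length.comp hu) hn
  have hpt : REPred fun q : Q => q.2.2.1.1 ++ q.2.2.1.2 = q.1.2.1 :=
    rePred_eq (Computable.list_append.comp hx hy) hA
  have hln : REPred fun q : Q => (bif q.2.1 then true :: (q.2.2.2.1 ++ q.2.2.2.2)
      else false :: q.2.2.2.1) = q.1.2.2 :=
    rePred_eq (Computable.cond hb
      (Computable.list_cons.comp (Computable.const true) (Computable.list_append.comp hc hd))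
      (Computable.list_cons.comp (Computable.const false) hc)) hC
  have hinc : REPred fun q : Q => (bif q.2.1 then
      add (q.1.1, mul (q.1.1, q.2.2.2.1, q.2.2.1.1), q.2.2.2.2) else q.2.2.1.1) =
        bif q.2.1 then q.2.2.1.2 else q.2.2.2.1 :=
    rePred_eq (Computable.cond hb
      (hadd.comp (hn.pair ((hmul.comp (hn.pair (hc.pair hx))).pair hd))) hx)
      (Computable.cond hb hy hc)
  have hpos : REPred fun q : ℕ × (List Bool × List Bool) => 1 ≤ q.1 := by
    refine (rePred_of_computable
      (Primrec.nat_le.decide.comp (Primrec.const 1) Primrec.fst).to_comp).of_eq fun q => ?_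
    simp
  refine (rePred_and hpos (rePred_exists (rePred_and (rePred_and (rePred_and (hlen hx) (hlen hy))
    (rePred_and (hlen hc) (hlen hd))) (rePred_and hpt (rePred_and hln hinc))))).of_eq ?_
  rintro ⟨n, A, C⟩
  refine and_congr_right fun hn => ?_
  dsimp only
  constructor
  · rintro ⟨⟨b, ⟨x, y⟩, c, d⟩, ⟨⟨hx, hy⟩, hc, hd⟩, hA, hC, h⟩
    dsimp only at hn hx hy hc hd hA hC h
    obtain ⟨x, rfl⟩ := henc.exists_eq hn hx
    obtain ⟨y, rfl⟩ := henc.exists_eq hn hy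
    obtain ⟨c, rfl⟩ := henc.exists_eq hn hc
    obtain ⟨d, rfl⟩ := henc.exists_eq hn hd
    cases b with
    | true =>
      rw [cond_true, cond_true, Hmul n hn, Hadd n hn] at h
      exact ⟨(x, y), Line.slanted c d, henc.injective hn h, hA, hC⟩
    | false => exact ⟨(x, y), Line.vertical c, henc.injective hn h, hA, hC⟩
  · rintro ⟨⟨x, y⟩, l, hl, hA, hC⟩
    dsimp only at hn hA hC
    have hL := fun x => henc.length_eq hn x
    cases l with
    | slanted c d =>
      refine ⟨(true, (enc n x, enc n y), (enc n c, enc n d)), ⟨⟨hL _, hL _⟩, hL _, hL _⟩, hA, hC,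
        ?_⟩
      dsimp only
      rw [cond_true, cond_true, Hmul n hn, Hadd n hn]
      exact congrArg _ hl
    | vertical c =>
      exact ⟨(false, (enc n x, enc n y), (enc n c, enc n c)), ⟨⟨hL _, hL _⟩, hL _, hL _⟩, hA, hC,
        congrArg (enc n) hl⟩

theorem IsEffectiveEncoding.incidentStrings_unique (henc : IsEffectiveEncoding enc) {n : ℕ}
    {A B C C' : List Bool} (hAB : A ≠ B) (hA : IncidentStrings enc (n, (A, C)))
    (hB : IncidentStrings enc (n, (B, C))) (hA' : IncidentStrings enc (n, (A, C')))
    (hB' : IncidentStrings enc (n, (B, C'))) : C = C' := by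
  obtain ⟨hn, P, l, hPl, hPA, hlC⟩ := hA
  obtain ⟨-, Q, l₂, hQl, hQB, hlC₂⟩ := hB
  obtain ⟨-, P', m, hPm, hPA', hmC⟩ := hA'
  obtain ⟨-, Q', m₂, hQm, hQB', hmC₂⟩ := hB'
  dsimp only at *
  obtain rfl := henc.lineString_injective hn (hlC.trans hlC₂.symm)
  obtain rfl := henc.lineString_injective hn (hmC.trans hmC₂.symm)
  obtain rfl := henc.pointString_injective hn (hPA.trans hPA'.symm)
  obtain rfl := henc.pointString_injective hn (hQB.trans hQB'.symm)
  have hPQ : P ≠ Q := by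
    rintro rfl
    exact hAB (hPA.symm.trans hQB)
  rw [← hlC, ← hmC, Line.incident_unique hPQ hPl hQl hPm hQm]

theorem IsEffectiveEncoding.encard_incidentStrings_le (henc : IsEffectiveEncoding enc) {n : ℕ}
    (hn : 1 ≤ n) (l : Line (GaloisField 2 n)) :
    {A | IncidentStrings enc (n, (A, lineString (enc n) l))}.encard ≤ 2 ^ n := by
  have hcard : ENat.card (GaloisField 2 n) = 2 ^ n := by
    have := Fact.mk Nat.prime_two
    rw [ENat.card_eq_coe_natCard, GaloisField.card 2 n (by omega)]
    norm_cast
  rw [← hcard]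
  refine (Set.encard_le_encard ?_).trans
    ((Set.encard_image_le (pointString (enc n)) _).trans l.encard_incident_le)
  rintro A ⟨-, P, m, hPm, hPA, hm⟩
  have hml : m = l := henc.lineString_injective hn hm
  exact ⟨P, hml ▸ hPm, hPA⟩

end AffinePlane

/-! ### The inequality for mutual informations -/

/-- Binary lengths of numbers linear in `N` are `O(log (N + 2))`, uniformly from `N = 0` on. -/
theorem exists_size_le_log (c : ℕ) :
    ∃ κ : ℝ, ∀ N : ℕ, ((3 * N + c).size : ℝ) ≤ κ * Real.log ((N : ℝ) + 2) := by
  have h2 : 0 < Real.log 2 := Real.log_pos one_lt_two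
  refine ⟨(2 + Real.log (c + 3) / Real.log 2) / Real.log 2, fun N => ?_⟩
  have hL : Real.log 2 ≤ Real.log ((N : ℝ) + 2) :=
    Real.log_le_log two_pos (by linarith [(Nat.cast_nonneg N : (0 : ℝ) ≤ N)])
  have hc : 0 ≤ Real.log ((c : ℝ) + 3) :=
    Real.log_nonneg (by linarith [(Nat.cast_nonneg c : (0 : ℝ) ≤ c)])
  have hsize : ((3 * N + c).size : ℝ) * Real.log 2 ≤
      Real.log 2 + Real.log ((c : ℝ) + 3) + Real.log ((N : ℝ) + 2) := by
    rw [← Real.log_mul (by positivity) (by positivity),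
      ← Real.log_mul (by positivity) (by positivity), ← Real.log_pow]
    refine Real.log_le_log (by positivity) ?_
    have h : 2 ^ (3 * N + c).size ≤ 2 * (c + 3) * (N + 2) := by
      rcases Nat.eq_zero_or_pos (3 * N + c) with h0 | h0
      · rw [h0, Nat.size_zero]
        nlinarith
      · have hlt : 2 ^ ((3 * N + c).size - 1) ≤ 3 * N + c :=
          Nat.lt_size.1 (Nat.sub_lt (Nat.size_pos.2 h0) one_pos)
        rw [← Nat.sub_add_cancel (Nat.size_pos.2 h0), pow_succ]
        nlinarith
    exact_mod_cast h
  rw [div_mul_eq_mul_div, le_div_iff₀ h2]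
  have hcL : Real.log ((c : ℝ) + 3) ≤
      Real.log ((c : ℝ) + 3) / Real.log 2 * Real.log ((N : ℝ) + 2) := by
    rw [div_mul_eq_mul_div, le_div_iff₀ h2]
    exact mul_le_mul_of_nonneg_left hL hc
  linarith

section MutualInformation

variable {U : ProgLang}

theorem IsUniversal.exists_complexity_le (hU : IsUniversal U) :
    ∃ c, ∀ x, complexity U x ≤ x.length + c := by
  obtain ⟨c, hc⟩ := hU.exists_complexity_le_length (f := fun x : List Bool => Part.some x)
    Computable.id (e := fun x => x) Computable.id Function.injective_id
  exact ⟨c, fun x => hc x x (Part.mem_some x)⟩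

/-- A subtuple of a quadruple is at most as complex as the quadruple. -/
theorem IsUniversal.exists_complexity_subtuple_le (hU : IsUniversal U) :
    ∃ c, ∀ A B C D : List Bool,
      tupleComplexity U [D, A] ≤ tupleComplexity U [A, B, C, D] + c ∧
      tupleComplexity U [D, B] ≤ tupleComplexity U [A, B, C, D] + c ∧
      tupleComplexity U [A, B, C] ≤ tupleComplexity U [A, B, C, D] + c := by
  let Q := (List Bool × List Bool) × (List Bool × List Bool)
  have hA : Primrec fun q : Q => q.1.1 := Primrec.fst.comp Primrec.fst
  have hB : Primrec fun q : Q => q.1.2 := Primrec.snd.comp Primrec.fst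
  have hC : Primrec fun q : Q => q.2.1 := Primrec.fst.comp Primrec.snd
  have hD : Primrec fun q : Q => q.2.2 := Primrec.snd.comp Primrec.snd
  have he : Computable fun q : Q => tuple [q.1.1, q.1.2, q.2.1, q.2.2] :=
    (primrec_tuple.comp (Primrec.list_cons.comp hA (Primrec.list_cons.comp hB
      (Primrec.list_cons.comp hC (Primrec.list_cons.comp hD (Primrec.const [])))))).to_comp
  have hinj : Function.Injective fun q : Q => tuple [q.1.1, q.1.2, q.2.1, q.2.2] := by
    rintro ⟨⟨A, B⟩, C, D⟩ ⟨⟨A', B'⟩, C', D'⟩ h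
    have := tuple_injective h
    simp_all
  obtain ⟨c₁, h₁⟩ := hU.exists_complexity_comp_le he hinj (primrec_tuple_two hD hA).to_comp
  obtain ⟨c₂, h₂⟩ := hU.exists_complexity_comp_le he hinj (primrec_tuple_two hD hB).to_comp
  obtain ⟨c₃, h₃⟩ := hU.exists_complexity_comp_le he hinj (primrec_tuple_three hA hB hC).to_comp
  refine ⟨c₁ + c₂ + c₃, fun A B C D => ?_⟩
  have e₁ := h₁ ((A, B), (C, D))
  have e₂ := h₂ ((A, B), (C, D))
  have e₃ := h₃ ((A, B), (C, D))
  simp only [tupleComplexity] at *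
  omega

/-- A point costs at most `n` bits once a line through it is known. -/
theorem IsUniversal.exists_complexity_point_le (hU : IsUniversal U)
    {enc : ∀ n : ℕ, GaloisField 2 n → List Bool} (henc : IsEffectiveEncoding enc)
    {Y : Type*} [Primcodable Y] {e : Y → List Bool} (he : Computable e) (hinj : e.Injective)
    {C : Y → List Bool} (hC : Computable C) {h : List Bool × Y → List Bool} (hh : Computable h) :
    ∃ c, ∀ n, 1 ≤ n → ∀ (l : Line (GaloisField 2 n)) y A, C y = lineString (enc n) l →
      IncidentStrings enc (n, (A, C y)) →
      complexity U (h (A, y)) ≤ complexity U (e y) + n + 4 * n.size + c := by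
  have hp : REPred fun q : (ℕ × Y) × List Bool => IncidentStrings enc (q.1.1, (q.2, C q.1.2)) :=
    rePred_comp henc.rePred_incidentStrings
      (f := fun q : (ℕ × Y) × List Bool => (q.1.1, (q.2, C q.1.2)))
      ((Computable.fst.comp Computable.fst).pair
        (Computable.snd.pair (hC.comp (Computable.snd.comp Computable.fst))))
  obtain ⟨c, hc⟩ := hU.exists_complexity_le_index he hinj hp (h := fun q => h (q.2, q.1.2))
    (hh.comp (Computable.snd.pair (Computable.snd.comp Computable.fst)))
  refine ⟨c, fun n hn l y A hl hA => ?_⟩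
  have := hc n y A n hA (by
    dsimp only
    rw [hl]
    exact henc.encard_incidentStrings_le hn l)
  simp only [Encodable.encode_nat] at this
  omega

/-- Adding a string of length at most `m` to a pair costs at most `m + 1` bits, up to a logarithmic
term. -/
theorem IsUniversal.exists_complexity_string_le (hU : IsUniversal U) :
    ∃ c, ∀ (m : ℕ) (C D A : List Bool), C.length ≤ m → tupleComplexity U [C, D, A] ≤
      tupleComplexity U [D, A] + (m + 1) + 4 * (m + 1).size + c := by
  have hp : REPred fun q : (ℕ × (List Bool × List Bool)) × List Bool => q.2.length ≤ q.1.1 := by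
    refine (rePred_of_computable (Primrec.nat_le.decide.comp (Primrec.list_length.comp Primrec.snd)
      (Primrec.fst.comp Primrec.fst)).to_comp).of_eq fun q => ?_
    simp
  obtain ⟨c, hc⟩ := hU.exists_complexity_le_index
    (primrec_tuple_two Primrec.fst Primrec.snd).to_comp tuple_two_injective hp
    (h := fun q => tuple [q.2, q.1.2.1, q.1.2.2])
    (primrec_tuple_three Primrec.snd (Primrec.fst.comp (Primrec.snd.comp Primrec.fst))
      (Primrec.snd.comp (Primrec.snd.comp Primrec.fst))).to_comp
  refine ⟨c, fun m C D A hC => ?_⟩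
  have h := hc m (D, A) C (m + 1) hC (encard_length_le m)
  have := Nat.size_le_size (Nat.le_succ m)
  simp only [Encodable.encode_nat, tupleComplexity, Nat.succ_eq_add_one] at *
  omega

/-- The inequality between the mutual informations, with the logarithmic term expressed as a binary
length.  If the triple `(A, B, C)` is as complex as possible, then `K(C) ≈ 2n` and
`K(A, C) - K(A) ≈ n ≈ K(B, C) - K(B)`, so that the terms without `D` cancel. -/
theorem IsUniversal.exists_mutualInfo_le (hU : IsUniversal U)
    {enc : ∀ n : ℕ, GaloisField 2 n → List Bool} (henc : IsEffectiveEncoding enc) (k : ℕ) :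
    ∃ c₀ c : ℕ, ∀ n, 1 ≤ n → ∀ (l : Line (GaloisField 2 n)) (A B C D : List Bool),
      C = lineString (enc n) l → IncidentStrings enc (n, (A, C)) →
      IncidentStrings enc (n, (B, C)) →
      |(tupleComplexity U [A, B, C] : ℤ) - 4 * (n : ℤ)| ≤ (k : ℤ) →
      mutualInfo U C D ≤ condMutualInfo U C D A + condMutualInfo U C D B +
        c * ((3 * tupleComplexity U [A, B, C, D] + (c₀ + 1)).size : ℤ) := by
  obtain ⟨c₁, h₁⟩ := hU.exists_complexity_le
  obtain ⟨c₂, h₂⟩ := hU.exists_complexity_subtuple_le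
  obtain ⟨c₃, h₃⟩ := hU.exists_complexity_string_le
  obtain ⟨c₄, h₄⟩ := hU.exists_complexity_incidence_le henc.rePred_incidentStrings
  have htwo : Computable fun q : List Bool × List Bool => tuple [q.1, q.2] :=
    (primrec_tuple_two Primrec.fst Primrec.snd).to_comp
  -- from the line and one point to the triple
  obtain ⟨c₅, h₅⟩ := hU.exists_complexity_point_le henc htwo tuple_two_injective
    (C := fun q => q.1) Computable.fst (h := fun r => tuple [r.2.2, r.1, r.2.1])
    (primrec_tuple_three (Primrec.snd.comp Primrec.snd) Primrec.fst
      (Primrec.fst.comp Primrec.snd)).to_comp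
  obtain ⟨c₆, h₆⟩ := hU.exists_complexity_point_le henc htwo tuple_two_injective
    (C := fun q => q.1) Computable.fst (h := fun r => tuple [r.1, r.2.2, r.2.1])
    (primrec_tuple_three Primrec.fst (Primrec.snd.comp Primrec.snd)
      (Primrec.fst.comp Primrec.snd)).to_comp
  -- from the line to the triple, if the points coincide
  obtain ⟨c₇, h₇⟩ := hU.exists_complexity_point_le henc (e := fun C : List Bool => C)
    Computable.id Function.injective_id (C := fun C => C) Computable.id
    (h := fun r => tuple [r.1, r.1, r.2])
    (primrec_tuple_three Primrec.fst Primrec.fst Primrec.snd).to_comp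
  obtain ⟨c₈, h₈⟩ := hU.exists_complexity_comp_le htwo tuple_two_injective
    (f := fun q => q.2) Computable.snd
  refine ⟨k + 3 * c₂ + 3,
    50 + (7 * c₁ + 2 * c₃ + c₄ + c₅ + c₆ + 4 * c₇ + c₈ + 6 * k + 9), ?_⟩
  intro n hn l A B C D hC hA hB hk
  obtain ⟨hk1, hk2⟩ := abs_le.1 hk
  obtain ⟨hDA, hDB, hABC⟩ := h₂ A B C D
  set N := tupleComplexity U [A, B, C, D] with hN
  set L := (3 * N + (k + 3 * c₂ + 3 + 1)).size with hL
  have hle : ∀ m, m ≤ 3 * N + (k + 3 * c₂ + 3 + 1) → m.size ≤ L := fun m hm =>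
    Nat.size_le_size hm
  have hL1 : 1 ≤ L := Nat.size_pos.2 (by omega)
  have hlenA : A.length = 2 * n := by
    obtain ⟨-, P, -, -, hP, -⟩ := hA
    dsimp only at hP
    rw [← hP, henc.length_pointString hn]
  have hlenB : B.length = 2 * n := by
    obtain ⟨-, P, -, -, hP, -⟩ := hB
    dsimp only at hP
    rw [← hP, henc.length_pointString hn]
  have hlenC : C.length ≤ 2 * n + 1 := by
    rw [hC]
    exact henc.length_lineString_le hn l
  have eA := h₁ A
  have eB := h₁ B
  have eC := h₁ C
  have e₅ := h₅ n hn l (C, A) B hC hB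
  have e₆ := h₆ n hn l (C, B) A hC hA
  have hsn := hle n (by omega)
  have hmain : tupleComplexity U [C, D, A] + tupleComplexity U [C, D, B] + complexity U D ≤
      tupleComplexity U [C, D] + tupleComplexity U [D, A] + tupleComplexity U [D, B] +
        42 * L + (4 * c₁ + 2 * c₃ + c₄ + 4 * c₇ + c₈ + 4 * k + 8) := by
    rcases eq_or_ne A B with rfl | hAB
    · -- the triple has complexity at most `3 * n`, so `n` is at most logarithmic
      have e₇ := h₇ n hn l C A hC hA
      have e₃ := h₃ (2 * n + 1) C D A hlenC
      have e₈ := h₈ (C, D)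
      have hs := hle (2 * n + 1 + 1) (by omega)
      simp only [tupleComplexity] at *
      omega
    · have e₄ := h₄ n A B C D (fun P Q l l' hPQ hPl hQl hPl' hQl' =>
        henc.incidentStrings_unique hPQ hPl hQl hPl' hQl') hA hB hAB
      have hs := hle (n + tupleComplexity U [D, A] + tupleComplexity U [D, B] + 4) (by omega)
      omega
  have hconst : ((7 * c₁ + 2 * c₃ + c₄ + c₅ + c₆ + 4 * c₇ + c₈ + 6 * k + 9 : ℕ) : ℤ) ≤
      ((7 * c₁ + 2 * c₃ + c₄ + c₅ + c₆ + 4 * c₇ + c₈ + 6 * k + 9 : ℕ) : ℤ) * (L : ℤ) :=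
    le_mul_of_one_le_right (Nat.cast_nonneg _) (by exact_mod_cast hL1)
  rw [Nat.cast_add, add_mul]
  simp only [mutualInfo, condMutualInfo]
  simp only [tupleComplexity] at *
  push_cast at hconst ⊢
  omega

end MutualInformation

end AlgInfo

theorem proposition1
    (U : AlgInfo.ProgLang) (hU : AlgInfo.IsUniversal U)
    (enc : ∀ n : ℕ, GaloisField 2 n → List Bool) (henc : AlgInfo.IsEffectiveEncoding enc)
    (k : ℕ) :
    ∃ κ : ℝ, ∀ n : ℕ, 1 ≤ n →
      ∀ (P Q : GaloisField 2 n × GaloisField 2 n) (l : AlgInfo.Line (GaloisField 2 n)),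
        l.Incident P → l.Incident Q →
        ∀ A B C : List Bool,
          A = AlgInfo.pointString (enc n) P →
          B = AlgInfo.pointString (enc n) Q →
          C = AlgInfo.lineString (enc n) l →
          |(AlgInfo.tupleComplexity U [A, B, C] : ℤ) - 4 * (n : ℤ)| ≤ (k : ℤ) →
          ∀ D : List Bool,
            (AlgInfo.mutualInfo U C D : ℝ) ≤
              (AlgInfo.condMutualInfo U C D A : ℝ) + (AlgInfo.condMutualInfo U C D B : ℝ)
                + κ * Real.log ((AlgInfo.tupleComplexity U [A, B, C, D] : ℝ) + 2) := by
  obtain ⟨c₀, c, hc⟩ := hU.exists_mutualInfo_le henc k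
  obtain ⟨κ, hκ⟩ := AlgInfo.exists_size_le_log (c₀ + 1)
  refine ⟨c * κ, fun n hn P Q l hP hQ A B C hA hB hC hk D => ?_⟩
  have h := hc n hn l A B C D hC ⟨hn, P, l, hP, hA.symm, hC.symm⟩
    ⟨hn, Q, l, hQ, hB.symm, hC.symm⟩ hk
  have h' : (AlgInfo.mutualInfo U C D : ℝ) ≤
      (AlgInfo.condMutualInfo U C D A : ℝ) + (AlgInfo.condMutualInfo U C D B : ℝ) +
        c * ((3 * AlgInfo.tupleComplexity U [A, B, C, D] + (c₀ + 1)).size : ℝ) := by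
    exact_mod_cast h
  refine h'.trans (add_le_add_right ?_ _)
  rw [mul_assoc]
  exact mul_le_mul_of_nonneg_left (hκ _) (Nat.cast_nonneg c)
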